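/- **Setting.** Consider $N$ players; player $i$ controls a Hermitian positive-semidefinite complex $M_i\times M_i$ matrix in $\mathcal X_i=\{X_i\succcurlyeq 0:\ \|X_i\|\le A_i\}$, where $A_i>0$ and $\|\cdot\|$ is the nuclear (trace) norm. Let $\mathcal X=\prod_i\mathcal X_i$, and identify a profile $X=(X_1,\dots,X_N)$ with the block-diagonal matrix $\operatorname{diag}(X_1,\dots,X_N)$. Each player has a payoff function $u_i:\mathcal X\to\mathbb R$ which is concave and differentiable in $X_i$. The individual payoff gradient $V_i(X)=\nabla_{X_i}u_i(X_i;X_{-i})$ is the Hermitian matrix with $u_i(X_i';X_{-i})=u_i(X)+\operatorname{tr}[(X_i'-X_i)V_i(X)]+o(\|X_i'-X_i\|)$ for $X_i'\to X_i$ in $\mathcal X_i$. Every $V_i$ is assumed to be continuous on $\mathcal X$; put $V(X)=\operatorname{diag}(V_1(X),\dots,V_N(X))$. A profile $X^*\in\mathcal X$ is *globally (variationally) stable* if $\operatorname{tr}[(X-X^*)V(X)]\le 0$ for all $X\in\mathcal X$, with equality if and only if $X=X^*$. *Matrix exponential learning* (MXL) with step sizes $\gamma_n>0$ and arbitrary Hermitian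 initial matrices $Y_i(0)$ is the recursion, for $n=0,1,2,\dots$, $$X_i(n)=A_i\frac{\exp(Y_i(n))}{1+\|\exp(Y_i(n))\|},\qquad Y_i(n+1)=Y_i(n)+\gamma_n\,\tfrac12\big(\hat V_i(n)+\hat V_i(n)^\dagger\big),\qquad \hat V_i(n)=V_i(X(n))+Z_i(n),$$ where the $Z(n)=\operatorname{diag}(Z_1(n),\dots,Z_N(n))$ are random complex matrices on a probability space. (Taking the Hermitian part changes nothing if the noise is Hermitian.) The noise satisfies, almost surely, for all $n$, - (H1) $\mathbb E[Z(n)\mid X(n)]=0$; - (H2) $\mathbb E[\|Z(n)\|_*^2\mid X(n)]\le\sigma_*^2$ for some constant $\sigma_*>0$ that does not depend on $n$, where $\|Z\|_*$ is the largest singular value of $Z$ (the largest absolute value of an eigenvalue if $Z$ is Hermitian). **Theorem.** Suppose that MXL is run with step sizes $\gamma_n>0$ such that $\sum_n\gamma_n^2<\infty$ and $\sum_n\gamma_n=\infty$, and with gradient noise satisfying (H1) and (H2). If $X^*\in\mathcal X$ is globally stable, then $X(n)\to X^*$ as $n\to\infty$, almost surely. -/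

import Mathlib

open MeasureTheory Filter Topology
open scoped Matrix ComplexOrder

noncomputable section

namespace MXL

/-- The sum `∑ⱼ |eigⱼ(B)|` of the absolute values of the eigenvalues of `B`, counted with algebraic
multiplicity. On Hermitian matrices (the only ones it is applied to below) this is the nuclear
(trace) norm. -/
def nuclearNorm {m : ℕ} (B : Matrix (Fin m) (Fin m) ℂ) : ℝ :=
  (B.charpoly.roots.map fun z => ‖z‖).sum

/-- The individual action set `{X ≽ 0 : ‖X‖ ≤ a}`. -/
def actionSet (m : ℕ) (a : ℝ) : Set (Matrix (Fin m) (Fin m) ℂ) :=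
  {X | X.PosSemidef ∧ nuclearNorm X ≤ a}

/-- Profiles `X = (X₁, …, X_N)`: player `i` has a complex `M i × M i` matrix. -/
abbrev Profile {N : ℕ} (M : Fin N → ℕ) : Type :=
  (i : Fin N) → Matrix (Fin (M i)) (Fin (M i)) ℂ

/-- The set of feasible profiles, `∏ᵢ {Xᵢ ≽ 0 : ‖Xᵢ‖ ≤ Aᵢ}`. -/
def feasible {N : ℕ} (M : Fin N → ℕ) (A : Fin N → ℝ) : Set (Profile M) :=
  {X | ∀ i, X i ∈ actionSet (M i) (A i)}

section
open scoped Matrix.Norms.L2Operator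

/-- The dual (singular) norm of a profile: the largest singular value of the block-diagonal matrix
`diag(Z₁, …, Z_N)`, that is the maximum over `i` of the spectral norms of the blocks. It equals
the largest absolute value of an eigenvalue if the blocks are Hermitian. -/
def dualNorm {N : ℕ} {M : Fin N → ℕ} (Z : Profile M) : ℝ := ‖Z‖

end

/-- The real-linear functional `H ↦ Re tr(H G)`; for Hermitian `H` and `G` the trace is real. -/
def traceCLM {m : ℕ} (G : Matrix (Fin m) (Fin m) ℂ) : Matrix (Fin m) (Fin m) ℂ →L[ℝ] ℝ where
  toFun H := (H * G).trace.re
  map_add' H K := by simp [add_mul]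
  map_smul' c H := by simp
  cont := by fun_prop

/-- `G` is the gradient with respect to `Xᵢ`, at the profile `X`, of the payoff `u` of player `i`:
`G` is Hermitian and `u(X'; X₋ᵢ) = u(X) + tr((X' - Xᵢ) G) + o(‖X' - Xᵢ‖)` as `X' → Xᵢ` within the
action set of player `i`. -/
def IsPayoffGradient {N : ℕ} (M : Fin N → ℕ) (A : Fin N → ℝ) (u : Profile M → ℝ) (i : Fin N)
    (X : Profile M) (G : Matrix (Fin (M i)) (Fin (M i)) ℂ) : Prop :=
  G.IsHermitian ∧
    HasFDerivWithinAt (𝕜 := ℝ) (fun X' => u (Function.update X i X')) (traceCLM G)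
      (actionSet (M i) (A i)) (X i)

open Classical in
/-- The individual payoff gradient `∇_{Xᵢ} u(Xᵢ; X₋ᵢ)`. -/
def payoffGradient {N : ℕ} (M : Fin N → ℕ) (A : Fin N → ℝ) (u : Profile M → ℝ) (i : Fin N)
    (X : Profile M) : Matrix (Fin (M i)) (Fin (M i)) ℂ :=
  if h : ∃ G, IsPayoffGradient M A u i X G then h.choose else 0

/-- A game with `N` players: player `i` maximizes `uᵢ(X₁, …, X_N)` over
`Xᵢ ≽ 0`, `‖Xᵢ‖ ≤ Aᵢ`. Payoffs are individually concave and continuously differentiable, in the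
sense that the individual payoff gradients exist and are continuous on the set of feasible
profiles. Only the values of the payoffs on feasible profiles matter. -/
structure Game (N : ℕ) where
  /-- the sizes of the players' matrices -/
  M : Fin N → ℕ
  /-- the bounds on the nuclear norms -/
  A : Fin N → ℝ
  A_pos : ∀ i, 0 < A i
  /-- the payoff functions -/
  u : Fin N → Profile M → ℝ
  concave : ∀ i, ∀ X ∈ feasible M A,
    ConcaveOn ℝ (actionSet (M i) (A i)) fun X' => u i (Function.update X i X')
  differentiable : ∀ i, ∀ X ∈ feasible M A, ∃ G, IsPayoffGradient M A (u i) i X G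
  continuous_gradient : ∀ i, ContinuousOn (payoffGradient M A (u i) i) (feasible M A)

namespace Game

variable {N : ℕ} (G : Game N)

/-- The profile `V(X) = diag(V₁(X), …, V_N(X))` of the individual payoff gradients. -/
def V (X : Profile G.M) : Profile G.M := fun i => payoffGradient G.M G.A (G.u i) i X

/-- `Xs` is globally (variationally) stable: `Xs` is feasible and `tr((X - Xs) V(X)) ≤ 0` for all
feasible `X`, with equality if and only if `X = Xs`. The trace is that of the block-diagonal
matrix, and it is real, since all the matrices are Hermitian. -/
def IsGloballyStable (Xs : Profile G.M) : Prop :=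
  Xs ∈ feasible G.M G.A ∧ ∀ X ∈ feasible G.M G.A,
    (∑ i, ((X i - Xs i) * G.V X i).trace.re) ≤ 0 ∧
      ((∑ i, ((X i - Xs i) * G.V X i).trace.re) = 0 ↔ X = Xs)

/-- The exponentiation step `Xᵢ = Aᵢ exp(Yᵢ) / (1 + ‖exp(Yᵢ)‖)`. -/
def expStep (Y : Profile G.M) : Profile G.M := fun i =>
  (G.A i / (1 + nuclearNorm (NormedSpace.exp (Y i)))) • NormedSpace.exp (Y i)

/-- The score matrices `Y(n)` of matrix exponential learning started at `Y(0) = Y₀`, when the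
feedback at stage `n` is `V(X(n)) + Z n`:
`Yᵢ(n+1) = Yᵢ(n) + γₙ (V̂ᵢ(n) + V̂ᵢ(n)ᴴ) / 2` with `V̂ᵢ(n) = Vᵢ(X(n)) + Zᵢ(n)`.
The Hermitian part is `V̂ᵢ(n)` itself if the noise is Hermitian. -/
def score (γ : ℕ → ℝ) (Y₀ : Profile G.M) (Z : ℕ → Profile G.M) : ℕ → Profile G.M
  | 0 => Y₀
  | n + 1 => fun i =>
      let Vhat := G.V (G.expStep (score γ Y₀ Z n)) i + Z n i
      score γ Y₀ Z n i + γ n • ((1 / 2 : ℝ) • (Vhat + Vhatᴴ))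

/-- The actions `X(n)` of matrix exponential learning. -/
def play (γ : ℕ → ℝ) (Y₀ : Profile G.M) (Z : ℕ → Profile G.M) (n : ℕ) : Profile G.M :=
  G.expStep (G.score γ Y₀ Z n)

end Game

section Noise

variable {Ω : Type*} [MeasurableSpace Ω] {N : ℕ} {M : Fin N → ℕ}

/-- The σ-algebra on `Ω` that is generated by the random profile `X`. -/
abbrev sigmaOf (X : Ω → Profile M) : MeasurableSpace Ω :=
  MeasurableSpace.comap X (borel (Profile M))

/-- (H1): `E[Z(n) | X(n)] = 0` almost surely for every `n`, entry by entry. -/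
def ZeroMean (μ : Measure Ω) (X Z : ℕ → Ω → Profile M) : Prop :=
  ∀ n i a b, Integrable (fun ω => Z n ω i a b) μ ∧
    μ[fun ω => Z n ω i a b | sigmaOf (X n)] =ᵐ[μ] 0

/-- (H2): there is a `σ > 0` such that `E[‖Z(n)‖² | X(n)] ≤ σ²` almost surely for every `n`, where
`‖·‖` is the dual norm. -/
def FiniteMSE (μ : Measure Ω) (X Z : ℕ → Ω → Profile M) : Prop :=
  ∃ σ : ℝ, 0 < σ ∧ ∀ n, Integrable (fun ω => dualNorm (Z n ω) ^ 2) μ ∧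
    ∀ᵐ ω ∂μ, (μ[fun ω => dualNorm (Z n ω) ^ 2 | sigmaOf (X n)]) ω ≤ σ ^ 2

end Noise

end MXL

end

/-! The energy `∑ᵢ (Aᵢ log(1 + tr exp Yᵢ) - tr(Yᵢ Xs ᵢ))` is a Lyapunov function: it is nonnegative
on Hermitian scores (`energy_nonneg`), its gradient in `Y` is `X - Xs` with `X = expStep Y`, and
that gradient is Lipschitz (`norm_gibbs_sub_le`). Hence one step changes it by at most `γₙ tr((X -
Xs)(V + Z))` plus a term of order `γₙ² (1 + ‖Z‖²)` (`energy_score_succ_le`).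

The noise is centred given `X(n)` only, not given the whole past, so the noise terms need not be
martingale differences and the argument uses expectations instead. These kill the noise pairing, and
telescoping gives `∑ γₙ E[-tr((X(n) - Xs) V(X(n)))] < ∞`. By compactness and stability the drift is
at most `-ε` at distance `≥ r` from `Xs`, so `∑ γₙ P(‖X(n) - Xs‖ ≥ r) < ∞`. The event is determined
by `X(n)`, so the conditional second-moment bound applies on it, and almost surely `γₙ (1 +
‖Z(n)‖²)` is summable over the times spent away from `Xs` (`ae_summable_excursions`).

The rest is pathwise. Steps of the play are at most a constant times `γₙ (C + ‖Z(n)‖)`; they tend to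
zero and are summable over excursions, while `∑ γₙ = ∞` forces returns near `Xs`. After a late
return the play cannot travel far again (`tendsto_zero_of_summable_excursions`). -/

noncomputable section

namespace MXL

/-! ### Matrix exponential: trace estimates, Gibbs map, log-partition function. -/

section MatrixExponential

open scoped Matrix.Norms.L2Operator

variable {m : ℕ}

/-- The real part of the trace of the exponential of a matrix. -/
def traceExp (Y : Matrix (Fin m) (Fin m) ℂ) : ℝ := (NormedSpace.exp Y).trace.re

theorem exp_smul_eq {Y : Matrix (Fin m) (Fin m) ℂ} (hY : Y.IsHermitian) (s : ℝ) :
    NormedSpace.exp (s • Y) = (hY.eigenvectorUnitary : Matrix (Fin m) (Fin m) ℂ) *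
      Matrix.diagonal (fun i => (Real.exp (s * hY.eigenvalues i) : ℂ)) *
      star (hY.eigenvectorUnitary : Matrix (Fin m) (Fin m) ℂ) := by
  have h1 : s • Y = (hY.eigenvectorUnitary : Matrix (Fin m) (Fin m) ℂ) *
      Matrix.diagonal (fun i => ((s * hY.eigenvalues i : ℝ) : ℂ)) *
      star (hY.eigenvectorUnitary : Matrix (Fin m) (Fin m) ℂ) := by
    conv_lhs => rw [hY.spectral_theorem, Unitary.conjStarAlgAut_apply]
    rw [← smul_mul_assoc, ← mul_smul_comm]
    congr 2
    ext i j
    by_cases hij : i = j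
    · subst hij; simp
    · simp [Matrix.diagonal_apply_ne _ hij]
  have h2 := Matrix.exp_units_conj (Unitary.toUnits hY.eigenvectorUnitary)
    (Matrix.diagonal (fun i => ((s * hY.eigenvalues i : ℝ) : ℂ)))
  rw [h1]
  refine h2.trans ?_
  rw [Matrix.exp_diagonal]
  congr 3
  ext i
  simp [Pi.coe_exp, ← Complex.exp_eq_exp_ℂ]

theorem exp_eq {Y : Matrix (Fin m) (Fin m) ℂ} (hY : Y.IsHermitian) :
    NormedSpace.exp Y = (hY.eigenvectorUnitary : Matrix (Fin m) (Fin m) ℂ) *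
      Matrix.diagonal (fun i => (Real.exp (hY.eigenvalues i) : ℂ)) *
      star (hY.eigenvectorUnitary : Matrix (Fin m) (Fin m) ℂ) := by
  simpa using exp_smul_eq hY 1

theorem traceExp_eq_sum {Y : Matrix (Fin m) (Fin m) ℂ} (hY : Y.IsHermitian) :
    traceExp Y = ∑ i, Real.exp (hY.eigenvalues i) := by
  rw [traceExp, exp_eq hY, Matrix.trace_mul_cycle, Unitary.coe_star_mul_self, one_mul,
    Matrix.trace_diagonal, Complex.re_sum]
  simp [Complex.exp_ofReal_re]

theorem traceExp_nonneg {Y : Matrix (Fin m) (Fin m) ℂ} (hY : Y.IsHermitian) : 0 ≤ traceExp Y := by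
  rw [traceExp_eq_sum hY]; positivity

theorem exp_eigenvalues_le_traceExp {Y : Matrix (Fin m) (Fin m) ℂ} (hY : Y.IsHermitian)
    (i : Fin m) : Real.exp (hY.eigenvalues i) ≤ traceExp Y := by
  rw [traceExp_eq_sum hY]
  exact Finset.single_le_sum (f := fun i => Real.exp (hY.eigenvalues i))
    (fun i _ => (Real.exp_pos _).le) (Finset.mem_univ i)

/-- Unitary invariance reduces this to eigenvalues, where `e^{sλ} = (e^λ)^s ≤ (tr exp Y)^s`. Keeping
the power `s` lets the two factors of an interpolation `exp((1-s)Y) · exp(sY')` recombine into a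
weighted geometric mean. -/
theorem norm_exp_smul_le {Y : Matrix (Fin m) (Fin m) ℂ} (hY : Y.IsHermitian) {s : ℝ}
    (hs : 0 ≤ s) : ‖NormedSpace.exp (s • Y)‖ ≤ traceExp Y ^ s := by
  rw [exp_smul_eq hY, ← Unitary.coe_star, CStarRing.norm_mul_coe_unitary,
    CStarRing.norm_coe_unitary_mul, Matrix.l2_opNorm_diagonal,
    pi_norm_le_iff_of_nonneg (Real.rpow_nonneg (traceExp_nonneg hY) _)]
  intro i
  rw [Complex.norm_real, Real.norm_of_nonneg (Real.exp_pos _).le, mul_comm, Real.exp_mul]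
  exact Real.rpow_le_rpow (Real.exp_pos _).le (exp_eigenvalues_le_traceExp hY i) hs

theorem norm_exp_le {Y : Matrix (Fin m) (Fin m) ℂ} (hY : Y.IsHermitian) :
    ‖NormedSpace.exp Y‖ ≤ traceExp Y := by
  simpa using norm_exp_smul_le hY zero_le_one

theorem posSemidef_exp {Y : Matrix (Fin m) (Fin m) ℂ} (hY : Y.IsHermitian) :
    (NormedSpace.exp Y).PosSemidef := by
  rw [exp_eq hY]
  refine Matrix.PosSemidef.mul_mul_conjTranspose_same (Matrix.PosSemidef.diagonal fun i => ?_) _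
  exact Complex.zero_le_real.2 (Real.exp_pos _).le

theorem nuclearNorm_eq_trace {B : Matrix (Fin m) (Fin m) ℂ} (hB : B.PosSemidef) :
    nuclearNorm B = B.trace.re := by
  rw [nuclearNorm, hB.isHermitian.roots_charpoly_eq_eigenvalues,
    hB.isHermitian.trace_eq_sum_eigenvalues, Complex.re_sum, Multiset.map_map]
  refine Finset.sum_congr rfl fun i _ => ?_
  simp [abs_of_nonneg (hB.eigenvalues_nonneg i)]

theorem norm_entry_le (B : Matrix (Fin m) (Fin m) ℂ) (i j : Fin m) : ‖B i j‖ ≤ ‖B‖ := by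
  have h := Matrix.l2_opNorm_mulVec B (EuclideanSpace.single j (1 : ℂ))
  rw [PiLp.norm_single, norm_one, mul_one] at h
  refine le_trans ?_ h
  refine le_trans (le_of_eq ?_) (PiLp.norm_apply_le _ i)
  simp

theorem abs_re_trace_le (B : Matrix (Fin m) (Fin m) ℂ) : |B.trace.re| ≤ m * ‖B‖ := by
  calc |B.trace.re| ≤ ‖B.trace‖ := Complex.abs_re_le_norm _
    _ ≤ ∑ i, ‖B i i‖ := norm_sum_le _ _
    _ ≤ ∑ _i : Fin m, ‖B‖ := Finset.sum_le_sum fun i _ => norm_entry_le B i i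
    _ = m * ‖B‖ := by simp

theorem abs_re_trace_mul_le (B C : Matrix (Fin m) (Fin m) ℂ) :
    |(B * C).trace.re| ≤ m * (‖B‖ * ‖C‖) :=
  (abs_re_trace_le _).trans (by gcongr; exact norm_mul_le _ _)

theorem rpow_mul_rpow_le_max {a b s : ℝ} (ha : 0 ≤ a) (hb : 0 ≤ b) (hs : s ∈ Set.Icc (0 : ℝ) 1) :
    a ^ (1 - s) * b ^ s ≤ max a b := by
  refine (Real.geom_mean_le_arith_mean2_weighted (sub_nonneg.2 hs.2) hs.1 ha hb (by ring)).trans ?_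
  have h1 := mul_le_mul_of_nonneg_left (le_max_left a b) (sub_nonneg.2 hs.2)
  have h2 := mul_le_mul_of_nonneg_left (le_max_right a b) hs.1
  linarith

/-- Differential form of Duhamel's formula: the curve joins `exp Y` at `s = 0` to `exp Y'` at `s =
1`, and no commutation of `Y` with `Y'` is needed because each exponential commutes with its own
exponent. -/
theorem hasDerivAt_exp_mul_exp (Y Y' : Matrix (Fin m) (Fin m) ℂ) (s : ℝ) :
    HasDerivAt (fun s : ℝ => NormedSpace.exp ((1 - s) • Y) * NormedSpace.exp (s • Y'))
      (NormedSpace.exp ((1 - s) • Y) * (Y' - Y) * NormedSpace.exp (s • Y')) s := by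
  have h1 : HasDerivAt (fun s : ℝ => NormedSpace.exp ((1 - s) • Y))
      ((-1 : ℝ) • (NormedSpace.exp ((1 - s) • Y) * Y)) s :=
    (hasDerivAt_exp_smul_const (𝕂 := ℝ) Y (1 - s)).scomp s ((hasDerivAt_id s).const_sub 1)
  have h2 : HasDerivAt (fun s : ℝ => NormedSpace.exp (s • Y'))
      (Y' * NormedSpace.exp (s • Y')) s := hasDerivAt_exp_smul_const' (𝕂 := ℝ) Y' s
  convert! h1.mul h2 using 1
  rw [neg_one_smul]
  noncomm_ring

theorem norm_exp_mul_exp_sub_le {Y Y' : Matrix (Fin m) (Fin m) ℂ} (hY : Y.IsHermitian)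
    (hY' : Y'.IsHermitian) {s : ℝ} (hs : s ∈ Set.Icc (0 : ℝ) 1) :
    ‖NormedSpace.exp ((1 - s) • Y) * NormedSpace.exp (s • Y') - NormedSpace.exp Y‖ ≤
      max (traceExp Y) (traceExp Y') * ‖Y' - Y‖ := by
  have hK : 0 ≤ max (traceExp Y) (traceExp Y') := le_max_of_le_left (traceExp_nonneg hY)
  have h := (convex_Icc (0 : ℝ) 1).norm_image_sub_le_of_norm_hasDerivWithin_le
    (C := max (traceExp Y) (traceExp Y') * ‖Y' - Y‖)
    (fun s _ => (hasDerivAt_exp_mul_exp Y Y' s).hasDerivWithinAt)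
    (fun s hs => ?_) (Set.left_mem_Icc.2 zero_le_one) hs
  · simp only [sub_zero, one_smul, zero_smul, NormedSpace.exp_zero, mul_one] at h
    refine h.trans (mul_le_of_le_one_right (by positivity) ?_)
    rw [Real.norm_of_nonneg hs.1]; exact hs.2
  · calc ‖NormedSpace.exp ((1 - s) • Y) * (Y' - Y) * NormedSpace.exp (s • Y')‖
        ≤ traceExp Y ^ (1 - s) * ‖Y' - Y‖ * traceExp Y' ^ s := by
          refine (norm_mul_le _ _).trans (mul_le_mul ((norm_mul_le _ _).trans ?_)
            (norm_exp_smul_le hY' hs.1) (norm_nonneg _) ?_)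
          · gcongr; exact norm_exp_smul_le hY (sub_nonneg.2 hs.2)
          · exact mul_nonneg (Real.rpow_nonneg (traceExp_nonneg hY) _) (norm_nonneg _)
      _ = traceExp Y ^ (1 - s) * traceExp Y' ^ s * ‖Y' - Y‖ := by ring
      _ ≤ _ := by
          gcongr
          exact rpow_mul_rpow_le_max (traceExp_nonneg hY) (traceExp_nonneg hY') hs

theorem norm_exp_sub_exp_le {Y Y' : Matrix (Fin m) (Fin m) ℂ} (hY : Y.IsHermitian)
    (hY' : Y'.IsHermitian) : ‖NormedSpace.exp Y' - NormedSpace.exp Y‖ ≤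
      max (traceExp Y) (traceExp Y') * ‖Y' - Y‖ := by
  simpa using norm_exp_mul_exp_sub_le hY hY' (Set.right_mem_Icc.2 zero_le_one)

theorem abs_traceExp_sub_le {Y Y' : Matrix (Fin m) (Fin m) ℂ} (hY : Y.IsHermitian)
    (hY' : Y'.IsHermitian) : |traceExp Y' - traceExp Y| ≤
      m * (max (traceExp Y) (traceExp Y') * ‖Y' - Y‖) := by
  have h := abs_re_trace_le (NormedSpace.exp Y' - NormedSpace.exp Y)
  rw [Matrix.trace_sub, Complex.sub_re] at h
  exact h.trans (by gcongr; exact norm_exp_sub_exp_le hY hY')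

/-- Cyclicity of the trace makes the first-order term the same as in the commutative case; the
remainder is again of the form controlled by `norm_exp_mul_exp_sub_le`, which supplies the second
factor `‖Y' - Y‖`. -/
theorem abs_traceExp_sub_sub_le {Y Y' : Matrix (Fin m) (Fin m) ℂ} (hY : Y.IsHermitian)
    (hY' : Y'.IsHermitian) :
    |traceExp Y' - traceExp Y - ((Y' - Y) * NormedSpace.exp Y).trace.re| ≤
      m * max (traceExp Y) (traceExp Y') * ‖Y' - Y‖ ^ 2 := by
  -- the trace of the Duhamel formula, with the factors in cyclic order
  have hd : ∀ s ∈ Set.Icc (0 : ℝ) 1, HasDerivWithinAt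
      (fun s : ℝ => (NormedSpace.exp ((1 - s) • Y') * NormedSpace.exp (s • Y)).trace.re +
        s * ((Y' - Y) * NormedSpace.exp Y).trace.re)
      ((((NormedSpace.exp ((1 - s) • Y') * (Y - Y') * NormedSpace.exp (s • Y)).trace.re) +
        ((Y' - Y) * NormedSpace.exp Y).trace.re)) (Set.Icc 0 1) s := by
    intro s _
    have h1 := (traceCLM (m := m) 1).hasFDerivAt.comp_hasDerivAt s (hasDerivAt_exp_mul_exp Y' Y s)
    have h2 := (hasDerivAt_id s).mul_const ((Y' - Y) * NormedSpace.exp Y).trace.re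
    have h3 := (h1.add h2).hasDerivWithinAt (s := Set.Icc (0 : ℝ) 1)
    convert! h3 using 1
    · ext s
      simp [traceCLM]
    · simp [traceCLM]
  have h := (convex_Icc (0 : ℝ) 1).norm_image_sub_le_of_norm_hasDerivWithin_le
    (C := m * max (traceExp Y) (traceExp Y') * ‖Y' - Y‖ ^ 2) hd (fun s hs => ?_)
    (Set.left_mem_Icc.2 zero_le_one) (Set.right_mem_Icc.2 zero_le_one)
  · simp only [sub_zero, one_smul, zero_smul, NormedSpace.exp_zero, mul_one, sub_self, one_mul,
      zero_mul, add_zero, norm_one] at h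
    rw [Real.norm_eq_abs, abs_sub_comm] at h
    convert h using 2
    simp only [traceExp]; ring
  -- After a cyclic rotation the derivative pairs `Y' - Y` with an interpolation based at `Y` with
  -- parameter `1 - s`; the added linear term subtracts its value `exp Y` at parameter zero.
  · have e : (NormedSpace.exp ((1 - s) • Y') * (Y - Y') * NormedSpace.exp (s • Y)).trace.re +
        ((Y' - Y) * NormedSpace.exp Y).trace.re =
        -((Y' - Y) * (NormedSpace.exp ((1 - (1 - s)) • Y) * NormedSpace.exp ((1 - s) • Y')
          - NormedSpace.exp Y)).trace.re := by
      rw [Matrix.trace_mul_cycle, Matrix.trace_mul_comm, mul_sub, Matrix.trace_sub, Complex.sub_re,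
        ← neg_sub Y' Y, neg_mul, Matrix.trace_neg, Complex.neg_re, sub_sub_cancel]
      ring
    rw [e, norm_neg, Real.norm_eq_abs]
    refine (abs_re_trace_mul_le _ _).trans ?_
    have := norm_exp_mul_exp_sub_le hY hY' (s := 1 - s) ⟨sub_nonneg.2 hs.2, by linarith [hs.1]⟩
    calc (m : ℝ) * (‖Y' - Y‖ * _) ≤ m * (‖Y' - Y‖ * (max (traceExp Y) (traceExp Y') * ‖Y' - Y‖)) := by
          gcongr
      _ = _ := by ring

theorem continuous_exp_matrix :
    Continuous (NormedSpace.exp : Matrix (Fin m) (Fin m) ℂ → Matrix (Fin m) (Fin m) ℂ) :=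
  letI : NormedAlgebra ℚ (Matrix (Fin m) (Fin m) ℂ) := NormedAlgebra.restrictScalars ℚ ℂ _
  NormedSpace.exp_continuous

theorem continuous_traceExp : Continuous (traceExp (m := m)) :=
  Complex.continuous_re.comp (continuous_exp_matrix.matrix_trace)

theorem hasDerivAt_traceExp {Y W : Matrix (Fin m) (Fin m) ℂ} (hY : Y.IsHermitian)
    (hW : W.IsHermitian) (s : ℝ) : HasDerivAt (fun s : ℝ => traceExp (Y + s • W))
      (W * NormedSpace.exp (Y + s • W)).trace.re s := by
  have hH : ∀ s : ℝ, (Y + s • W).IsHermitian := fun s => hY.add (hW.smul (IsSelfAdjoint.all s))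
  have hc : Continuous fun s : ℝ => traceExp (Y + s • W) := continuous_traceExp.comp (by fun_prop)
  rw [hasDerivAt_iff_isLittleO]
  have hb : (fun t : ℝ => m * max (traceExp (Y + s • W)) (traceExp (Y + t • W)) * ‖W‖ ^ 2)
      =O[𝓝 s] fun _ => (1 : ℝ) :=
    ((by fun_prop : Continuous fun t : ℝ =>
      m * max (traceExp (Y + s • W)) (traceExp (Y + t • W)) * ‖W‖ ^ 2).tendsto s).isBigO_one ℝ
  have ho : (fun t : ℝ => (t - s) ^ 2) =o[𝓝 s] fun t => t - s := by
    have := (Asymptotics.isLittleO_pow_id (𝕜 := ℝ) one_lt_two).comp_tendsto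
      (tendsto_sub_nhds_zero_iff.2 (tendsto_id (α := ℝ) (x := 𝓝 s)))
    simpa [Function.comp_def] using this
  refine (Asymptotics.IsBigO.of_bound' (Eventually.of_forall fun t => ?_)).trans_isLittleO
    (by simpa using hb.mul_isLittleO ho)
  have := abs_traceExp_sub_sub_le (hH s) (hH t)
  have e : Y + t • W - (Y + s • W) = (t - s) • W := by rw [sub_smul]; abel
  rw [e, smul_mul_assoc, Matrix.trace_smul, Complex.smul_re, norm_smul] at this
  rw [Real.norm_eq_abs]
  refine this.trans (le_of_eq ?_)
  rw [mul_pow, Real.norm_eq_abs (t - s), sq_abs, Real.norm_of_nonneg]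
  · ring
  · have := traceExp_nonneg (hH s)
    have : 0 ≤ max (traceExp (Y + s • W)) (traceExp (Y + t • W)) := le_max_of_le_left this
    positivity

/-- The exponential of `Y`, divided by one plus its trace. -/
def gibbs (Y : Matrix (Fin m) (Fin m) ℂ) : Matrix (Fin m) (Fin m) ℂ :=
  (1 / (1 + traceExp Y)) • NormedSpace.exp Y

theorem measurable_gibbs [MeasurableSpace (Matrix (Fin m) (Fin m) ℂ)]
    [BorelSpace (Matrix (Fin m) (Fin m) ℂ)] : Measurable (gibbs (m := m)) :=
  (measurable_const.div (measurable_const.add continuous_traceExp.measurable)).smul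
    continuous_exp_matrix.measurable

/-- With the traces ordered, the maximum in the exponential estimates is `traceExp Y'`, which the
denominator `1 + traceExp Y'` absorbs; so the constant does not depend on the matrices. The `1`
comes from varying the exponential, the `m` from varying the normalization. -/
theorem norm_gibbs_sub_le_of_traceExp_le {Y Y' : Matrix (Fin m) (Fin m) ℂ} (hY : Y.IsHermitian)
    (hY' : Y'.IsHermitian) (h : traceExp Y ≤ traceExp Y') :
    ‖gibbs Y' - gibbs Y‖ ≤ (1 + m) * ‖Y' - Y‖ := by
  have h0 := traceExp_nonneg hY
  have h0' := traceExp_nonneg hY'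
  have e : gibbs Y' - gibbs Y = (1 / (1 + traceExp Y')) • (NormedSpace.exp Y' - NormedSpace.exp Y)
      + ((traceExp Y - traceExp Y') / ((1 + traceExp Y') * (1 + traceExp Y))) •
        NormedSpace.exp Y := by
    have : (traceExp Y - traceExp Y') / ((1 + traceExp Y') * (1 + traceExp Y)) =
        1 / (1 + traceExp Y') - 1 / (1 + traceExp Y) := by field_simp; ring
    rw [this, gibbs, gibbs, smul_sub, sub_smul]
    abel
  have h1 := norm_exp_sub_exp_le hY hY'
  have h2 := abs_traceExp_sub_le hY hY'
  rw [max_eq_right h] at h1 h2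
  rw [abs_sub_comm] at h2
  rw [e]
  refine (norm_add_le _ _).trans ?_
  rw [norm_smul, norm_smul, Real.norm_of_nonneg (by positivity), norm_div, Real.norm_eq_abs,
    Real.norm_of_nonneg (by positivity : 0 ≤ (1 + traceExp Y') * (1 + traceExp Y)), add_mul 1 (m : ℝ), one_mul]
  refine add_le_add ?_ ?_
  · rw [div_mul_eq_mul_div, one_mul, div_le_iff₀ (by positivity)]
    nlinarith [norm_nonneg (Y' - Y)]
  · rw [div_mul_eq_mul_div, div_le_iff₀ (by positivity)]
    calc |traceExp Y - traceExp Y'| * ‖NormedSpace.exp Y‖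
        ≤ m * (traceExp Y' * ‖Y' - Y‖) * traceExp Y := by
          gcongr; exact norm_exp_le hY
      _ = m * ‖Y' - Y‖ * (traceExp Y' * traceExp Y) := by ring
      _ ≤ _ := by gcongr <;> linarith

theorem norm_gibbs_sub_le {Y Y' : Matrix (Fin m) (Fin m) ℂ} (hY : Y.IsHermitian)
    (hY' : Y'.IsHermitian) : ‖gibbs Y' - gibbs Y‖ ≤ (1 + m) * ‖Y' - Y‖ := by
  rcases le_total (traceExp Y) (traceExp Y') with h | h
  · exact norm_gibbs_sub_le_of_traceExp_le hY hY' h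
  · rw [norm_sub_rev, norm_sub_rev Y']
    exact norm_gibbs_sub_le_of_traceExp_le hY' hY h

/-- The logarithm of one plus the trace of the exponential. -/
def logPartition (Y : Matrix (Fin m) (Fin m) ℂ) : ℝ := Real.log (1 + traceExp Y)

theorem hasDerivAt_logPartition {Y W : Matrix (Fin m) (Fin m) ℂ} (hY : Y.IsHermitian)
    (hW : W.IsHermitian) (s : ℝ) : HasDerivAt (fun s : ℝ => logPartition (Y + s • W))
      (W * gibbs (Y + s • W)).trace.re s := by
  have hH : (Y + s • W).IsHermitian := hY.add (hW.smul (IsSelfAdjoint.all s))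
  have h0 := traceExp_nonneg hH
  convert! ((hasDerivAt_traceExp hY hW s).const_add 1).log (by positivity) using 1
  rw [gibbs, mul_smul_comm, Matrix.trace_smul, Complex.smul_re, smul_eq_mul]
  ring

/-- Descent inequality for a function with Lipschitz gradient `gibbs`: `1 + m` is the Lipschitz
constant, and the extra `m` is the cost of bounding a trace by the operator norm. -/
theorem logPartition_le {Y W : Matrix (Fin m) (Fin m) ℂ} (hY : Y.IsHermitian)
    (hW : W.IsHermitian) : logPartition (Y + W) ≤
      logPartition Y + (W * gibbs Y).trace.re + m * (1 + m) * ‖W‖ ^ 2 := by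
  have hH : ∀ s : ℝ, (Y + s • W).IsHermitian := fun s => hY.add (hW.smul (IsSelfAdjoint.all s))
  have hd : ∀ s ∈ Set.Icc (0 : ℝ) 1, HasDerivWithinAt
      (fun s : ℝ => logPartition (Y + s • W) - s * (W * gibbs Y).trace.re)
      ((W * (gibbs (Y + s • W) - gibbs Y)).trace.re) (Set.Icc 0 1) s := by
    intro s _
    rw [mul_sub, Matrix.trace_sub, Complex.sub_re]
    convert! ((hasDerivAt_logPartition hY hW s).sub
      ((hasDerivAt_id s).mul_const (W * gibbs Y).trace.re)).hasDerivWithinAt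
        (s := Set.Icc (0 : ℝ) 1) using 1
    rw [one_mul]
  have h := (convex_Icc (0 : ℝ) 1).norm_image_sub_le_of_norm_hasDerivWithin_le
    (C := m * (1 + m) * ‖W‖ ^ 2) hd (fun s hs => ?_)
    (Set.left_mem_Icc.2 zero_le_one) (Set.right_mem_Icc.2 zero_le_one)
  · simp only [one_smul, zero_smul, one_mul, zero_mul, add_zero, sub_zero, norm_one, mul_one] at h
    linarith [(abs_le.1 (Real.norm_eq_abs _ ▸ h)).2]
  · rw [Real.norm_eq_abs]
    refine (abs_re_trace_mul_le _ _).trans ?_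
    have h1 := norm_gibbs_sub_le hY (hH s)
    rw [add_sub_cancel_left, norm_smul, Real.norm_of_nonneg hs.1] at h1
    calc (m : ℝ) * (‖W‖ * ‖gibbs (Y + s • W) - gibbs Y‖)
        ≤ m * (‖W‖ * ((1 + m) * (1 * ‖W‖))) := by
          gcongr
          refine h1.trans ?_
          gcongr
          exact hs.2
      _ = _ := by ring

theorem eigenvalues_le_logPartition {Y : Matrix (Fin m) (Fin m) ℂ} (hY : Y.IsHermitian)
    (i : Fin m) : hY.eigenvalues i ≤ logPartition Y := by
  rw [logPartition, Real.le_log_iff_exp_le (by linarith [traceExp_nonneg hY])]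
  linarith [exp_eigenvalues_le_traceExp hY i]

theorem logPartition_nonneg {Y : Matrix (Fin m) (Fin m) ℂ} (hY : Y.IsHermitian) :
    0 ≤ logPartition Y := Real.log_nonneg (by linarith [traceExp_nonneg hY])

/-- In an eigenbasis of `Y` the trace is a sum of eigenvalues weighted by the diagonal of `B`, which
is nonnegative, and every eigenvalue is at most `logPartition Y`. This is what bounds the energy
from below. -/
theorem re_trace_mul_le_logPartition {Y B : Matrix (Fin m) (Fin m) ℂ} (hY : Y.IsHermitian)
    (hB : B.PosSemidef) : (Y * B).trace.re ≤ logPartition Y * B.trace.re := by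
  set U : Matrix (Fin m) (Fin m) ℂ := ↑hY.eigenvectorUnitary with hU
  have hUU : U * star U = 1 := Unitary.coe_mul_star_self _
  set D := star U * B * U with hD
  have hDp : D.PosSemidef := hB.conjTranspose_mul_mul_same U
  have e1 : (Y * B).trace = ∑ i, (hY.eigenvalues i : ℂ) * D i i := by
    conv_lhs => rw [hY.spectral_theorem, Unitary.conjStarAlgAut_apply]
    rw [mul_assoc, mul_assoc, Matrix.trace_mul_comm, mul_assoc, mul_assoc, ← mul_assoc _ B]
    simp only [Matrix.trace, Matrix.diag_apply, Matrix.diagonal_mul]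
    rfl
  have e2 : B.trace = ∑ i, D i i := by
    change _ = D.trace
    rw [hD, Matrix.trace_mul_comm, ← mul_assoc, hUU, one_mul]
  rw [e1, e2, Complex.re_sum, Complex.re_sum, Finset.mul_sum]
  refine Finset.sum_le_sum fun i _ => ?_
  rw [Complex.re_ofReal_mul]
  exact mul_le_mul_of_nonneg_right (eigenvalues_le_logPartition hY i)
    (Complex.nonneg_iff.1 hDp.diag_nonneg).1

end MatrixExponential

/-! ### Real sequences, almost sure summability and conditional expectation. -/

section Auxiliary

/-- A nonnegative sequence that is infinitely often close to zero, with steps that tend to zero and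
are summable over the times at which the sequence is bounded away from zero, tends to zero. -/
theorem tendsto_zero_of_summable_excursions {d δ : ℕ → ℝ} (hd : ∀ n, 0 ≤ d n)
    (hδ : ∀ n, 0 ≤ δ n) (hstep : ∀ n, d (n + 1) ≤ d n + δ n) (hδ0 : Tendsto δ atTop (𝓝 0))
    (hsum : ∀ r > 0, Summable fun n => if r ≤ d n then δ n else 0)
    (hfreq : ∀ r > 0, ∃ᶠ n in atTop, d n < r) : Tendsto d atTop (𝓝 0) := by
  rw [Metric.tendsto_atTop]
  intro ε hε
  set r := ε / 3 with hr_def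
  have hr : 0 < r := by positivity
  set f : ℕ → ℝ := fun n => if r ≤ d n then δ n else 0 with hf
  have hf0 : ∀ n, 0 ≤ f n := fun n => by simp only [hf]; split_ifs <;> simp [hδ]
  have hS := (hsum r hr).hasSum.tendsto_sum_nat
  have hle : ∀ n, ∑ k ∈ Finset.range n, f k ≤ ∑' k, f k := fun n =>
    (hsum r hr).sum_le_tsum _ fun k _ => hf0 k
  have hev := ((hS.eventually (lt_mem_nhds (by linarith : ∑' k, f k - r < ∑' k, f k))).and
    (hδ0.eventually (gt_mem_nhds hr)))
  obtain ⟨N, hN⟩ := eventually_atTop.1 hev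
  obtain ⟨p, hpN, hp⟩ := (frequently_atTop.1 (hfreq r hr)) N
  -- Past `N` the remaining excursion sum and every single step are below `r`. A step from below `r`
  -- lands below `2r`; a step from above `r` is charged to the excursion sum. The total stays below
  -- `3r = ε`.
  have key : ∀ n, p ≤ n →
      d n ≤ 2 * r + (∑ k ∈ Finset.range n, f k - ∑ k ∈ Finset.range p, f k) := by
    intro n hn
    induction n, hn using Nat.le_induction with
    | base => linarith
    | succ n hn ih =>
      rw [Finset.sum_range_succ]
      have h1 := hstep n
      by_cases h : r ≤ d n
      · have : f n = δ n := if_pos h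
        linarith
      · have h2 := (hN n (hpN.trans hn)).2
        have h3 : ∑ k ∈ Finset.range p, f k ≤ ∑ k ∈ Finset.range n, f k :=
          Finset.sum_le_sum_of_subset_of_nonneg (Finset.range_mono hn) fun k _ _ => hf0 k
        linarith [hf0 n, not_le.1 h]
  refine ⟨p, fun n hn => ?_⟩
  rw [Real.dist_0_eq_abs, abs_of_nonneg (hd n)]
  have := key n hn
  have := hle n
  have := (hN p hpN).1
  linarith

/-- Otherwise the indicator is eventually one and `γ` itself would be summable. -/
theorem frequently_lt_of_summable_indicator {γ d : ℕ → ℝ} {r : ℝ}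
    (hγ_sum : Tendsto (fun n => ∑ k ∈ Finset.range n, γ k) atTop atTop)
    (h : Summable fun n => if r ≤ d n then γ n else 0) : ∃ᶠ n in atTop, d n < r := by
  by_contra hcon
  rw [not_frequently] at hcon
  have : Summable γ := h.congr_atTop (hcon.mono fun n hn => if_pos (not_lt.1 hn))
  exact not_tendsto_nhds_of_tendsto_atTop hγ_sum _ this.hasSum.tendsto_sum_nat

variable {Ω : Type*} {mΩ : MeasurableSpace Ω} {μ : Measure Ω}

/-- By Tonelli the sum has finite integral, so it is finite almost everywhere. -/
theorem ae_summable_of_summable_integral {f : ℕ → Ω → ℝ} (hf0 : ∀ n ω, 0 ≤ f n ω)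
    (hf : ∀ n, Integrable (f n) μ) (hs : Summable fun n => ∫ ω, f n ω ∂μ) :
    ∀ᵐ ω ∂μ, Summable fun n => f n ω := by
  have hmeas : ∀ n, AEMeasurable (fun ω => ENNReal.ofReal (f n ω)) μ := fun n =>
    (hf n).aestronglyMeasurable.aemeasurable.ennreal_ofReal
  have hfin : ∫⁻ ω, ∑' n, ENNReal.ofReal (f n ω) ∂μ ≠ ⊤ := by
    rw [lintegral_tsum hmeas]
    have : ∀ n, ∫⁻ ω, ENNReal.ofReal (f n ω) ∂μ = ENNReal.ofReal (∫ ω, f n ω ∂μ) := fun n =>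
      (ofReal_integral_eq_lintegral_ofReal (hf n) (Eventually.of_forall (hf0 n))).symm
    simp_rw [this]
    rw [← ENNReal.ofReal_tsum_of_nonneg (fun n => integral_nonneg (hf0 n)) hs]
    exact ENNReal.ofReal_ne_top
  filter_upwards [ae_lt_top' (AEMeasurable.tsum hmeas) hfin] with ω hω
  have := ENNReal.summable_toReal hω.ne
  simpa [ENNReal.toReal_ofReal (hf0 _ ω)] using this

theorem integrable_mul_and_integral_mul_eq_zero [IsFiniteMeasure μ] {m : MeasurableSpace Ω}
    (hm : m ≤ mΩ)
    {f g : Ω → ℂ} (hf : StronglyMeasurable[m] f) {c : ℝ} (hfc : ∀ ω, ‖f ω‖ ≤ c)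
    (hg : Integrable g μ) (hg0 : μ[g | m] =ᵐ[μ] 0) :
    Integrable (fun ω => f ω * g ω) μ ∧ ∫ ω, f ω * g ω ∂μ = 0 := by
  have hi : Integrable (fun ω => f ω * g ω) μ :=
    hg.bdd_mul (hf.mono hm).aestronglyMeasurable (Eventually.of_forall hfc)
  refine ⟨hi, ?_⟩
  have h := condExp_bilin_of_stronglyMeasurable_left (ContinuousLinearMap.mul ℝ ℂ) hf hi hg
  rw [← integral_condExp hm, ← integral_zero Ω ℂ (μ := μ)]
  refine integral_congr_ae (h.trans ?_)
  filter_upwards [hg0] with ω hω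
  simp [hω]

theorem setIntegral_le_of_condExp_le [IsFiniteMeasure μ] {m : MeasurableSpace Ω} (hm : m ≤ mΩ)
    {f : Ω → ℝ} (hf : Integrable f μ) {c : ℝ} (hc : ∀ᵐ ω ∂μ, (μ[f | m]) ω ≤ c) {s : Set Ω}
    (hs : MeasurableSet[m] s) : ∫ ω in s, f ω ∂μ ≤ c * μ.real s := by
  rw [← setIntegral_condExp hm hf hs]
  calc ∫ ω in s, (μ[f | m]) ω ∂μ ≤ ∫ _ω in s, c ∂μ :=
        integral_mono_ae integrable_condExp.integrableOn (integrable_const _).integrableOn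
          (ae_restrict_of_ae hc)
    _ = c * μ.real s := by rw [setIntegral_const, smul_eq_mul, mul_comm]

end Auxiliary

/-! ### Borel structure on matrices and profiles. -/

instance instMeasurableSpaceMatrix {m : ℕ} : MeasurableSpace (Matrix (Fin m) (Fin m) ℂ) :=
  inferInstanceAs (MeasurableSpace (Fin m → Fin m → ℂ))

instance instBorelSpaceMatrix {m : ℕ} : BorelSpace (Matrix (Fin m) (Fin m) ℂ) :=
  inferInstanceAs (BorelSpace (Fin m → Fin m → ℂ))

instance instSecondCountableTopologyMatrix {m : ℕ} :
    SecondCountableTopology (Matrix (Fin m) (Fin m) ℂ) :=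
  inferInstanceAs (SecondCountableTopology (Fin m → Fin m → ℂ))

theorem measurable_profile {Ω : Type*} [MeasurableSpace Ω] {N : ℕ} {M : Fin N → ℕ}
    {Z : Ω → Profile M} (h : ∀ i a b, Measurable fun ω => Z ω i a b) : Measurable Z :=
  measurable_pi_lambda _ fun i => measurable_pi_lambda _ fun a => measurable_pi_lambda _ fun b =>
    h i a b

/-! ### Compactness of the action sets. -/

section ActionSet

open scoped Matrix.Norms.L2Operator

variable {m : ℕ}

theorem norm_le_trace {B : Matrix (Fin m) (Fin m) ℂ} (hB : B.PosSemidef) :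
    ‖B‖ ≤ B.trace.re := by
  have htr : B.trace.re = ∑ i, hB.isHermitian.eigenvalues i := by
    rw [hB.isHermitian.trace_eq_sum_eigenvalues, Complex.re_sum]
    rfl
  rw [htr]
  conv_lhs => rw [hB.isHermitian.spectral_theorem, Unitary.conjStarAlgAut_apply,
    ← Unitary.coe_star, CStarRing.norm_mul_coe_unitary, CStarRing.norm_coe_unitary_mul,
    Matrix.l2_opNorm_diagonal]
  rw [pi_norm_le_iff_of_nonneg (Finset.sum_nonneg fun i _ => hB.eigenvalues_nonneg i)]
  intro i
  rw [Function.comp_apply, RCLike.norm_ofReal, abs_of_nonneg (hB.eigenvalues_nonneg i)]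
  exact Finset.single_le_sum (fun i _ => hB.eigenvalues_nonneg i) (Finset.mem_univ i)

theorem actionSet_eq (a : ℝ) :
    actionSet m a = {X | X.PosSemidef ∧ X.trace.re ≤ a} := by
  ext X
  exact and_congr_right fun hX => by rw [nuclearNorm_eq_trace hX]

theorem isClosed_posSemidef : IsClosed {X : Matrix (Fin m) (Fin m) ℂ | X.PosSemidef} := by
  simp_rw [Matrix.posSemidef_iff_dotProduct_mulVec, Set.ofPred_and, Set.ofPred_forall]
  refine IsClosed.inter (isClosed_eq (by fun_prop) continuous_id) (isClosed_iInter fun x => ?_)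
  simp_rw [Complex.nonneg_iff, Set.ofPred_and]
  have hc : Continuous fun X : Matrix (Fin m) (Fin m) ℂ => star x ⬝ᵥ X *ᵥ x := by fun_prop
  exact (isClosed_le continuous_const (Complex.continuous_re.comp hc)).inter
    (isClosed_eq continuous_const (Complex.continuous_im.comp hc))

theorem isCompact_actionSet (a : ℝ) : IsCompact (actionSet m a) := by
  refine (isCompact_closedBall (0 : Matrix (Fin m) (Fin m) ℂ) a).of_isClosed_subset ?_ ?_
  · rw [actionSet_eq, Set.ofPred_and]
    exact isClosed_posSemidef.inter (isClosed_le (by fun_prop) continuous_const)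
  · intro X hX
    rw [actionSet_eq] at hX
    rw [mem_closedBall_zero_iff]
    exact (norm_le_trace hX.1).trans hX.2

theorem isCompact_feasible {N : ℕ} (M : Fin N → ℕ) (A : Fin N → ℝ) :
    IsCompact (feasible M A) := by
  have := isCompact_univ_pi fun i => isCompact_actionSet (m := M i) (A i)
  simpa [Set.pi, feasible] using this

end ActionSet

/-! ### Energy and one-step estimates for the learning recursion. -/

namespace Game

open scoped Matrix.Norms.L2Operator

variable {N : ℕ} (G : Game N)

theorem expStep_apply {Y : Profile G.M} {i : Fin N} (hY : (Y i).IsHermitian) :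
    G.expStep Y i = G.A i • gibbs (Y i) := by
  rw [expStep, nuclearNorm_eq_trace (posSemidef_exp hY), gibbs, smul_smul, mul_one_div]
  rfl

theorem expStep_mem_feasible {Y : Profile G.M} (hY : ∀ i, (Y i).IsHermitian) :
    G.expStep Y ∈ feasible G.M G.A := by
  intro i
  have h0 := traceExp_nonneg (hY i)
  have hA := G.A_pos i
  rw [actionSet_eq, G.expStep_apply (hY i), gibbs, smul_smul]
  have hc : 0 ≤ G.A i * (1 / (1 + traceExp (Y i))) := by positivity
  refine ⟨(posSemidef_exp (hY i)).smul hc, ?_⟩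
  rw [Matrix.trace_smul, Complex.smul_re, smul_eq_mul]
  change _ * traceExp (Y i) ≤ _
  rw [mul_assoc, one_div_mul_eq_div]
  exact mul_le_of_le_one_right hA.le ((div_le_one (by positivity)).2 (by linarith))

theorem isHermitian_score (γ : ℕ → ℝ) {Y₀ : Profile G.M} (hY₀ : ∀ i, (Y₀ i).IsHermitian)
    (Z : ℕ → Profile G.M) (n : ℕ) (i : Fin N) : (G.score γ Y₀ Z n i).IsHermitian := by
  induction n with
  | zero => exact hY₀ i
  | succ n ih =>
    exact ih.add (((Matrix.isHermitian_add_transpose_self _).smul (IsSelfAdjoint.all _)).smul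
      (IsSelfAdjoint.all _))

theorem continuousOn_V : ContinuousOn G.V (feasible G.M G.A) :=
  continuousOn_pi.2 fun i => G.continuous_gradient i

/-- The pairing `tr((X - Xs) V)` of profiles. -/
def pairing (Xs X V : Profile G.M) : ℝ := ∑ i, ((X i - Xs i) * V i).trace.re

/-- The energy of a score profile relative to `Xs`; up to a constant it is the Fenchel coupling. -/
def energy (Xs Y : Profile G.M) : ℝ :=
  ∑ i, (G.A i * logPartition (Y i) - (Y i * Xs i).trace.re)

/-- A Fenchel–Young inequality. Since only `tr Xs ᵢ ≤ Aᵢ` is known, it also needs `logPartition ≥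
0`, which the `1 +` in the normalization provides. -/
theorem energy_nonneg {Xs Y : Profile G.M} (hXs : Xs ∈ feasible G.M G.A)
    (hY : ∀ i, (Y i).IsHermitian) : 0 ≤ G.energy Xs Y := by
  refine Finset.sum_nonneg fun i _ => ?_
  have h := hXs i
  rw [actionSet_eq] at h
  have h1 := re_trace_mul_le_logPartition (hY i) h.1
  have h2 := mul_le_mul_of_nonneg_left h.2 (logPartition_nonneg (hY i))
  linarith [mul_comm (G.A i) (logPartition (Y i))]

theorem energy_add_le {Xs Y W : Profile G.M} (hY : ∀ i, (Y i).IsHermitian)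
    (hW : ∀ i, (W i).IsHermitian) :
    G.energy Xs (Y + W) ≤ G.energy Xs Y + G.pairing Xs (G.expStep Y) W +
      (∑ i, G.A i * (G.M i * (1 + G.M i))) * ‖W‖ ^ 2 := by
  rw [energy, energy, pairing, Finset.sum_mul, ← Finset.sum_add_distrib, ← Finset.sum_add_distrib]
  refine Finset.sum_le_sum fun i _ => ?_
  have hA := G.A_pos i
  have h := mul_le_mul_of_nonneg_left (logPartition_le (hY i) (hW i)) hA.le
  have h1 : G.A i * (G.M i * (1 + G.M i) * ‖W i‖ ^ 2) ≤
      G.A i * (G.M i * (1 + G.M i) * ‖W‖ ^ 2) := by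
    gcongr
    exact norm_le_pi_norm W i
  rw [G.expStep_apply (hY i), sub_mul, Matrix.trace_sub, Complex.sub_re, smul_mul_assoc,
    Matrix.trace_smul, Complex.smul_re, smul_eq_mul, Matrix.trace_mul_comm (gibbs (Y i)),
    Matrix.trace_mul_comm (Xs i), Pi.add_apply, add_mul, Matrix.trace_add, Complex.add_re]
  linarith

theorem norm_expStep_sub_le {Y Y' : Profile G.M} (hY : ∀ i, (Y i).IsHermitian)
    (hY' : ∀ i, (Y' i).IsHermitian) :
    ‖G.expStep Y' - G.expStep Y‖ ≤ (∑ i, G.A i * (1 + G.M i)) * ‖Y' - Y‖ := by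
  have hp : ∀ i, 0 ≤ G.A i * (1 + (G.M i : ℝ)) := fun i => by have := G.A_pos i; positivity
  rw [pi_norm_le_iff_of_nonneg (mul_nonneg (Finset.sum_nonneg fun i _ => hp i) (norm_nonneg _))]
  intro i
  have hA := G.A_pos i
  rw [Pi.sub_apply, G.expStep_apply (hY i), G.expStep_apply (hY' i), ← smul_sub, norm_smul,
    Real.norm_of_nonneg hA.le]
  calc G.A i * ‖gibbs (Y' i) - gibbs (Y i)‖ ≤ G.A i * ((1 + G.M i) * ‖(Y' - Y) i‖) := by
        gcongr
        exact norm_gibbs_sub_le (hY i) (hY' i)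
    _ ≤ G.A i * (1 + G.M i) * ‖Y' - Y‖ := by
        rw [← mul_assoc]
        exact mul_le_mul_of_nonneg_left (norm_le_pi_norm _ i) (hp i)
    _ ≤ _ := mul_le_mul_of_nonneg_right
        (Finset.single_le_sum (f := fun i => G.A i * (1 + (G.M i : ℝ))) (fun i _ => hp i)
          (Finset.mem_univ i)) (norm_nonneg _)

/-- The Hermitian part of a profile. -/
def hermitianPart (V : Profile G.M) : Profile G.M := fun i => (1 / 2 : ℝ) • (V i + (V i)ᴴ)

theorem score_succ (γ : ℕ → ℝ) (Y₀ : Profile G.M) (Z : ℕ → Profile G.M) (n : ℕ) :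
    G.score γ Y₀ Z (n + 1) =
      G.score γ Y₀ Z n + γ n • G.hermitianPart (G.V (G.play γ Y₀ Z n) + Z n) := rfl

theorem isHermitian_hermitianPart (V : Profile G.M) (i : Fin N) :
    (G.hermitianPart V i).IsHermitian :=
  (Matrix.isHermitian_add_transpose_self _).smul (IsSelfAdjoint.all _)

theorem norm_hermitianPart_le (V : Profile G.M) : ‖G.hermitianPart V‖ ≤ ‖V‖ := by
  rw [pi_norm_le_iff_of_nonneg (norm_nonneg _)]
  intro i
  have h1 := norm_add_le (V i) (V i)ᴴ
  rw [Matrix.l2_opNorm_conjTranspose] at h1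
  have h2 := norm_le_pi_norm V i
  rw [hermitianPart, norm_smul, Real.norm_of_nonneg (by norm_num)]
  linarith

/-- For Hermitian `H`, `tr(H Vᴴ)` is the conjugate of `tr(H V)`, so symmetrizing the feedback does
not affect the drift. -/
theorem pairing_hermitianPart {Xs X : Profile G.M} (hXs : ∀ i, (Xs i).IsHermitian)
    (hX : ∀ i, (X i).IsHermitian) (V : Profile G.M) :
    G.pairing Xs X (G.hermitianPart V) = G.pairing Xs X V := by
  refine Finset.sum_congr rfl fun i _ => ?_
  have h : ((X i - Xs i) * (V i)ᴴ).trace.re = ((X i - Xs i) * V i).trace.re := by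
    rw [Matrix.trace_mul_comm]
    have h1 : (V i)ᴴ * (X i - Xs i) = ((X i - Xs i) * V i)ᴴ := by
      rw [Matrix.conjTranspose_mul, ((hX i).sub (hXs i)).eq]
    rw [h1, Matrix.trace_conjTranspose]
    rfl
  rw [hermitianPart, mul_smul_comm, Matrix.trace_smul, Complex.smul_re, mul_add, Matrix.trace_add,
    Complex.add_re, h, smul_eq_mul]
  ring

theorem pairing_add (Xs X V W : Profile G.M) :
    G.pairing Xs X (V + W) = G.pairing Xs X V + G.pairing Xs X W := by
  simp [pairing, mul_add, Finset.sum_add_distrib]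

theorem pairing_smul (Xs X V : Profile G.M) (c : ℝ) :
    G.pairing Xs X (c • V) = c * G.pairing Xs X V := by
  simp [pairing, Finset.mul_sum]

theorem continuousOn_pairing_V (Xs : Profile G.M) :
    ContinuousOn (fun X => G.pairing Xs X (G.V X)) (feasible G.M G.A) := by
  have hV := continuousOn_pi.1 G.continuousOn_V
  have hp : ∀ i, ContinuousOn (fun X : Profile G.M => X i - Xs i) (feasible G.M G.A) :=
    fun i => (by fun_prop : Continuous fun X : Profile G.M => X i - Xs i).continuousOn
  refine continuousOn_finsetSum _ fun i _ => ?_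
  exact (Complex.continuous_re.comp (continuous_id.matrix_trace)).comp_continuousOn
    ((hp i).mul (hV i))

/-- The pairing attains its maximum on the compact set of feasible profiles at distance at least
`r`, and the equality case of stability makes that maximum negative. -/
theorem exists_pairing_le_neg {Xs : Profile G.M} (hXs : G.IsGloballyStable Xs) {r : ℝ}
    (hr : 0 < r) : ∃ ε > 0, ∀ X ∈ feasible G.M G.A, r ≤ ‖X - Xs‖ →
      G.pairing Xs X (G.V X) ≤ -ε := by
  have hK : IsCompact (feasible G.M G.A ∩ {X | r ≤ ‖X - Xs‖}) :=
    (isCompact_feasible G.M G.A).inter_right (isClosed_le continuous_const (by fun_prop))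
  rcases (feasible G.M G.A ∩ {X | r ≤ ‖X - Xs‖}).eq_empty_or_nonempty with h | h
  · refine ⟨1, one_pos, fun X hX hr' => ?_⟩
    exact (Set.eq_empty_iff_forall_notMem.1 h X ⟨hX, hr'⟩).elim
  · obtain ⟨X₁, hX₁, hmax⟩ := hK.exists_isMaxOn h
      ((G.continuousOn_pairing_V Xs).mono Set.inter_subset_left)
    have hs := hXs.2 X₁ hX₁.1
    have hne : X₁ ≠ Xs := by
      rintro rfl
      have := hX₁.2
      simp only [Set.mem_ofPred_eq, sub_self, norm_zero] at this
      linarith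
    have hlt : G.pairing Xs X₁ (G.V X₁) < 0 := lt_of_le_of_ne hs.1 fun h0 => hne (hs.2.1 h0)
    exact ⟨-G.pairing Xs X₁ (G.V X₁), neg_pos.2 hlt, fun X hX hr' => by
      rw [neg_neg]; exact hmax ⟨hX, hr'⟩⟩

/-- One step of matrix exponential learning changes the energy by at most the pairing with the
feedback, up to a second-order term. -/
theorem energy_score_succ_le (γ : ℕ → ℝ) {Y₀ : Profile G.M} (hY₀ : ∀ i, (Y₀ i).IsHermitian)
    (Z : ℕ → Profile G.M) {Xs : Profile G.M} (hXs : Xs ∈ feasible G.M G.A) {C : ℝ}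
    (hC : ∀ X ∈ feasible G.M G.A, ‖G.V X‖ ≤ C) (n : ℕ) :
    G.energy Xs (G.score γ Y₀ Z (n + 1)) ≤ G.energy Xs (G.score γ Y₀ Z n) +
      γ n * (G.pairing Xs (G.play γ Y₀ Z n) (G.V (G.play γ Y₀ Z n)) +
        G.pairing Xs (G.play γ Y₀ Z n) (Z n)) +
      (∑ i, G.A i * (G.M i * (1 + G.M i))) * (γ n ^ 2 * (2 * C ^ 2 + 2 * ‖Z n‖ ^ 2)) := by
  have hY := G.isHermitian_score γ hY₀ Z n
  have hX : G.play γ Y₀ Z n ∈ feasible G.M G.A := G.expStep_mem_feasible hY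
  have hK : 0 ≤ ∑ i, G.A i * (G.M i * (1 + (G.M i : ℝ))) :=
    Finset.sum_nonneg fun i _ => by have := G.A_pos i; positivity
  have h := G.energy_add_le (Xs := Xs) (W := γ n • G.hermitianPart (G.V (G.play γ Y₀ Z n) + Z n))
    hY fun i => (G.isHermitian_hermitianPart _ i).smul (IsSelfAdjoint.all (γ n))
  change _ ≤ _ + G.pairing Xs (G.play γ Y₀ Z n) _ + _ at h
  rw [← G.score_succ, G.pairing_smul, G.pairing_hermitianPart (fun i => (hXs i).1.isHermitian)
    (fun i => (hX i).1.isHermitian), G.pairing_add] at h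
  refine h.trans (add_le_add_right (mul_le_mul_of_nonneg_left ?_ hK) _)
  rw [norm_smul, mul_pow, Real.norm_eq_abs, sq_abs]
  gcongr
  have h1 := (G.norm_hermitianPart_le (G.V (G.play γ Y₀ Z n) + Z n)).trans (norm_add_le _ _)
  have h2 : ‖G.V (G.play γ Y₀ Z n)‖ ≤ C := hC _ hX
  have h3 : ‖G.hermitianPart (G.V (G.play γ Y₀ Z n) + Z n)‖ ^ 2 ≤ (C + ‖Z n‖) ^ 2 := by
    gcongr; linarith
  linarith [sq_nonneg (C - ‖Z n‖)]

theorem norm_play_succ_sub_le {γ : ℕ → ℝ} (hγ : ∀ n, 0 < γ n) {Y₀ : Profile G.M}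
    (hY₀ : ∀ i, (Y₀ i).IsHermitian) (Z : ℕ → Profile G.M) {C : ℝ}
    (hC : ∀ X ∈ feasible G.M G.A, ‖G.V X‖ ≤ C) (n : ℕ) :
    ‖G.play γ Y₀ Z (n + 1) - G.play γ Y₀ Z n‖ ≤
      (∑ i, G.A i * (1 + G.M i)) * (γ n * (C + ‖Z n‖)) := by
  have hY := G.isHermitian_score γ hY₀ Z
  have hL : 0 ≤ ∑ i, G.A i * (1 + (G.M i : ℝ)) :=
    Finset.sum_nonneg fun i _ => by have := G.A_pos i; positivity
  refine (G.norm_expStep_sub_le (hY n) (hY (n + 1))).trans (mul_le_mul_of_nonneg_left ?_ hL)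
  rw [G.score_succ, add_sub_cancel_left, norm_smul, Real.norm_of_nonneg (hγ n).le]
  have h2 : ‖G.V (G.play γ Y₀ Z n)‖ ≤ C := hC _ (G.expStep_mem_feasible (hY n))
  have := (G.norm_hermitianPart_le (G.V (G.play γ Y₀ Z n) + Z n)).trans (norm_add_le _ _)
  exact mul_le_mul_of_nonneg_left (by linarith) (hγ n).le

/-! ### Measurability of the process and the mean of the noise pairing. -/

variable {Ω : Type*}

theorem sigmaOf_eq_comap (X : Ω → Profile G.M) :
    sigmaOf X = MeasurableSpace.comap X inferInstance := by
  rw [sigmaOf, BorelSpace.measurable_eq (α := Profile G.M)]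

variable [MeasurableSpace Ω]

/-- Nothing is known about `f` off the feasible set, so it is replaced there by zero, which does not
change the composition. -/
theorem measurable_comp_of_continuousOn_feasible {β : Type*} [TopologicalSpace β]
    [MeasurableSpace β] [BorelSpace β] [Zero β] {f : Profile G.M → β}
    (hf : ContinuousOn f (feasible G.M G.A)) {X : Ω → Profile G.M} (hX : Measurable X)
    (hXf : ∀ ω, X ω ∈ feasible G.M G.A) : Measurable fun ω => f (X ω) := by
  classical
  have h := (hf.measurable_piecewise (continuousOn_const (c := (0 : β)))
    (isCompact_feasible G.M G.A).isClosed.measurableSet).comp hX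
  convert! h using 1
  ext ω
  simp [Set.piecewise, hXf ω]

theorem measurable_expStep_comp {Y : Ω → Profile G.M} (hY : Measurable Y)
    (hYh : ∀ ω i, (Y ω i).IsHermitian) : Measurable fun ω => G.expStep (Y ω) := by
  refine measurable_pi_lambda _ fun i => ?_
  have h : (fun ω => G.expStep (Y ω) i) = fun ω => G.A i • gibbs (Y ω i) :=
    funext fun ω => G.expStep_apply (hYh ω i)
  rw [h]
  have hi : Measurable fun ω => Y ω i := (measurable_pi_apply i).comp hY
  exact (measurable_gibbs.comp hi).const_smul (G.A i)

theorem measurable_score (γ : ℕ → ℝ) {Y₀ : Profile G.M} (hY₀ : ∀ i, (Y₀ i).IsHermitian)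
    {Z : ℕ → Ω → Profile G.M} (hZ : ∀ n, Measurable (Z n)) (n : ℕ) :
    Measurable fun ω => G.score γ Y₀ (fun k => Z k ω) n := by
  induction n with
  | zero => exact measurable_const
  | succ n ih =>
    have hYh := fun ω => G.isHermitian_score γ hY₀ (fun k => Z k ω) n
    have hV := G.measurable_comp_of_continuousOn_feasible G.continuousOn_V (G.measurable_expStep_comp ih hYh)
      fun ω => G.expStep_mem_feasible (hYh ω)
    have hc : Continuous G.hermitianPart :=
      continuous_pi fun i => by unfold hermitianPart; fun_prop
    exact ih.add ((hc.measurable.comp (hV.add (hZ n))).const_smul (γ n))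

theorem measurable_energy_comp (Xs : Profile G.M) {Y : Ω → Profile G.M} (hY : Measurable Y) :
    Measurable fun ω => G.energy Xs (Y ω) := by
  refine Finset.measurable_sum _ fun i _ => ?_
  have hi : Measurable fun ω => Y ω i := (measurable_pi_apply i).comp hY
  have hc : Continuous fun B : Matrix (Fin (G.M i)) (Fin (G.M i)) ℂ => (B * Xs i).trace.re :=
    Complex.continuous_re.comp (by fun_prop)
  exact ((((measurable_const.add continuous_traceExp.measurable).log).comp hi).const_mul _).sub
    (hc.measurable.comp hi)

theorem pairing_eq_sum (Xs X V : Profile G.M) : G.pairing Xs X V =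
    ∑ i, ∑ a, ∑ b, ((X i a b - Xs i a b) * V i b a).re := by
  simp [pairing, Matrix.trace, Matrix.mul_apply]

/-- Noise with zero mean conditional on the current action has zero mean pairing with it. -/
theorem integrable_pairing_and_integral_eq_zero {μ : Measure Ω} [IsFiniteMeasure μ]
    {X Z : Ω → Profile G.M} (hX : Measurable X) (Xs : Profile G.M) {B : ℝ}
    (hB : ∀ ω, ‖X ω - Xs‖ ≤ B)
    (hZ : ∀ i a b, Integrable (fun ω => Z ω i a b) μ ∧
      μ[fun ω => Z ω i a b | sigmaOf X] =ᵐ[μ] 0) :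
    Integrable (fun ω => G.pairing Xs (X ω) (Z ω)) μ ∧
      ∫ ω, G.pairing Xs (X ω) (Z ω) ∂μ = 0 := by
  have hm : sigmaOf X ≤ ‹MeasurableSpace Ω› := by
    rw [G.sigmaOf_eq_comap]; exact hX.comap_le
  have key : ∀ i a b, Integrable (fun ω => ((X ω i a b - Xs i a b) * Z ω i b a).re) μ ∧
      ∫ ω, ((X ω i a b - Xs i a b) * Z ω i b a).re ∂μ = 0 := by
    intro i a b
    have hf : StronglyMeasurable[sigmaOf X] fun ω => X ω i a b - Xs i a b := by
      have hc : Continuous fun X : Profile G.M => X i a b - Xs i a b := by fun_prop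
      rw [G.sigmaOf_eq_comap]
      exact (hc.measurable.comp (comap_measurable X)).stronglyMeasurable
    have h := integrable_mul_and_integral_mul_eq_zero hm hf
      (fun ω => ((norm_entry_le (X ω i - Xs i) a b).trans
        (norm_le_pi_norm (X ω - Xs) i)).trans (hB ω)) (hZ i b a).1 (hZ i b a).2
    refine ⟨h.1.re, ?_⟩
    have := integral_re h.1
    rw [h.2] at this
    simpa using this
  simp_rw [G.pairing_eq_sum]
  have i1 := fun i a b => (key i a b).1
  have i2 := fun i a => integrable_finsetSum Finset.univ fun b _ => i1 i a b
  have i3 := fun i => integrable_finsetSum Finset.univ fun a _ => i2 i a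
  refine ⟨integrable_finsetSum _ fun i _ => i3 i, ?_⟩
  rw [integral_finsetSum _ fun i _ => i3 i]
  refine Finset.sum_eq_zero fun i _ => ?_
  rw [integral_finsetSum _ fun a _ => i2 i a]
  refine Finset.sum_eq_zero fun a _ => ?_
  rw [integral_finsetSum _ fun b _ => i1 i a b]
  exact Finset.sum_eq_zero fun b _ => (key i a b).2

end Game

/-! ### Almost sure convergence. -/

namespace Game

open scoped Matrix.Norms.L2Operator

variable {N : ℕ} (G : Game N) {Ω : Type*} [MeasurableSpace Ω] {μ : Measure Ω}

/-- The expected payoff deficits along the play are summable against the step sizes. -/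
theorem summable_integral_neg_pairing [IsProbabilityMeasure μ] {γ : ℕ → ℝ} (hγ : ∀ n, 0 < γ n)
    (hγ_sq : Summable fun n => γ n ^ 2) {Y₀ : Profile G.M} (hY₀ : ∀ i, (Y₀ i).IsHermitian)
    {Z : ℕ → Ω → Profile G.M} (hZ : ∀ n, Measurable (Z n)) {X : ℕ → Ω → Profile G.M}
    (hX : ∀ n ω, X n ω = G.play γ Y₀ (fun k => Z k ω) n) (hXm : ∀ n, Measurable (X n))
    (hXf : ∀ n ω, X n ω ∈ feasible G.M G.A) (hH1 : ZeroMean μ X Z) {τ : ℝ}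
    (hZi : ∀ n, Integrable (fun ω => ‖Z n ω‖ ^ 2) μ) (hZτ : ∀ n, ∫ ω, ‖Z n ω‖ ^ 2 ∂μ ≤ τ)
    {Xs : Profile G.M} (hXs : G.IsGloballyStable Xs) :
    (∀ n, Integrable (fun ω => G.pairing Xs (X n ω) (G.V (X n ω))) μ) ∧
      Summable fun n => γ n * ∫ ω, -G.pairing Xs (X n ω) (G.V (X n ω)) ∂μ := by
  have hcpt := isCompact_feasible G.M G.A
  obtain ⟨C, hC⟩ := hcpt.exists_bound_of_continuousOn G.continuousOn_V
  obtain ⟨D, hD⟩ := hcpt.exists_bound_of_continuousOn (G.continuousOn_pairing_V Xs)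
  obtain ⟨B, hB⟩ := hcpt.exists_bound_of_continuousOn
    (f := fun X : Profile G.M => X - Xs) (by fun_prop)
  set K := ∑ i, G.A i * (G.M i * (1 + (G.M i : ℝ))) with hK_def
  have hK : 0 ≤ K := Finset.sum_nonneg fun i _ => by have := G.A_pos i; positivity
  set v : ℕ → Ω → ℝ := fun n ω => G.pairing Xs (X n ω) (G.V (X n ω)) with hv
  set ψ : ℕ → Ω → ℝ := fun n ω => G.pairing Xs (X n ω) (Z n ω) with hψ
  set F : ℕ → Ω → ℝ := fun n ω => G.energy Xs (G.score γ Y₀ (fun k => Z k ω) n) with hF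
  have hv_int : ∀ n, Integrable (v n) μ := fun n =>
    (integrable_const D).mono' (G.measurable_comp_of_continuousOn_feasible
      (G.continuousOn_pairing_V Xs) (hXm n) (hXf n)).aestronglyMeasurable
      (Eventually.of_forall fun ω => hD _ (hXf n ω))
  have hψ' := fun n => G.integrable_pairing_and_integral_eq_zero (μ := μ) (hXm n) Xs
    (fun ω => hB _ (hXf n ω)) (hH1 n)
  have hF0 : ∀ n ω, 0 ≤ F n ω := fun n ω =>
    G.energy_nonneg hXs.1 (G.isHermitian_score γ hY₀ _ n)
  have hstep : ∀ n ω, F (n + 1) ω ≤ F n ω + γ n * (v n ω + ψ n ω) +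
      K * (γ n ^ 2 * (2 * C ^ 2 + 2 * ‖Z n ω‖ ^ 2)) := fun n ω => by
    have := G.energy_score_succ_le γ hY₀ (fun k => Z k ω) hXs.1 hC n
    rw [← hX] at this
    exact this
  have hR : ∀ n, Integrable (fun ω => K * (γ n ^ 2 * (2 * C ^ 2 + 2 * ‖Z n ω‖ ^ 2))) μ :=
    fun n => (((integrable_const _).add ((hZi n).const_mul 2)).const_mul _).const_mul _
  have hQ : ∀ n, Integrable (fun ω => γ n * (v n ω + ψ n ω)) μ :=
    fun n => ((hv_int n).add (hψ' n).1).const_mul _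
  -- Integrability propagates because the energy lies between zero and the integrable right-hand
  -- side of `hstep`.
  have hF_int : ∀ n, Integrable (F n) μ := by
    intro n
    induction n with
    | zero => exact integrable_const (G.energy Xs Y₀)
    | succ n ih =>
      exact integrable_of_le_of_le
        (G.measurable_energy_comp Xs (G.measurable_score γ hY₀ hZ (n + 1))).aestronglyMeasurable
        (Eventually.of_forall (hF0 (n + 1))) (Eventually.of_forall (hstep n))
        (integrable_zero _ _ _) ((ih.add (hQ n)).add (hR n))
  have hEstep : ∀ n, ∫ ω, F (n + 1) ω ∂μ ≤ ∫ ω, F n ω ∂μ + γ n * ∫ ω, v n ω ∂μ +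
      K * (γ n ^ 2 * (2 * C ^ 2 + 2 * τ)) := fun n => by
    have h := integral_mono (hF_int (n + 1)) (((hF_int n).add (hQ n)).add (hR n)) (hstep n)
    simp only [Pi.add_apply] at h
    rw [integral_add (by exact (hF_int n).add (hQ n)) (hR n), integral_add (hF_int n) (hQ n),
      integral_const_mul, integral_add (hv_int n) (hψ' n).1, (hψ' n).2, add_zero,
      integral_const_mul, integral_const_mul,
      integral_add (integrable_const _) ((hZi n).const_mul 2), integral_const_mul,
      integral_const, probReal_univ, one_smul, integral_const_mul] at h
    refine h.trans ?_
    have := hZτ n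
    gcongr
  -- Telescoped energy inequality; the final energy is nonnegative and can then be dropped.
  have hsum : ∀ n, ∑ k ∈ Finset.range n, γ k * ∫ ω, -v k ω ∂μ + ∫ ω, F n ω ∂μ ≤
      ∫ ω, F 0 ω ∂μ + K * (2 * C ^ 2 + 2 * τ) * ∑ k ∈ Finset.range n, γ k ^ 2 := by
    intro n
    induction n with
    | zero => simp
    | succ n ih =>
      rw [Finset.sum_range_succ, Finset.sum_range_succ, integral_neg]
      linarith [hEstep n]
  have hτ : 0 ≤ τ := (integral_nonneg fun ω => by positivity).trans (hZτ 0)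
  refine ⟨hv_int, summable_of_sum_range_le
    (c := ∫ ω, F 0 ω ∂μ + K * (2 * C ^ 2 + 2 * τ) * ∑' k, γ k ^ 2) (fun n => ?_) fun n => ?_⟩
  · exact mul_nonneg (hγ n).le (integral_nonneg fun ω => neg_nonneg.2 (hXs.2 _ (hXf n ω)).1)
  · have h1 : 0 ≤ ∫ ω, F n ω ∂μ := integral_nonneg (hF0 n)
    have h2 := hγ_sq.sum_le_tsum (Finset.range n) fun k _ => sq_nonneg _
    have h3 := mul_le_mul_of_nonneg_left h2 (by positivity : 0 ≤ K * (2 * C ^ 2 + 2 * τ))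
    linarith [hsum n]

/-- Almost surely, the steps of the play are summable over the times at which it is at distance at
least `r` from the globally stable profile. -/
theorem ae_summable_excursions [IsProbabilityMeasure μ] {γ : ℕ → ℝ} (hγ : ∀ n, 0 < γ n)
    {Z : ℕ → Ω → Profile G.M} {X : ℕ → Ω → Profile G.M} (hXm : ∀ n, Measurable (X n))
    (hXf : ∀ n ω, X n ω ∈ feasible G.M G.A) {τ : ℝ}
    (hZi : ∀ n, Integrable (fun ω => ‖Z n ω‖ ^ 2) μ)
    (hZτ : ∀ n, ∀ᵐ ω ∂μ, (μ[fun ω => ‖Z n ω‖ ^ 2 | sigmaOf (X n)]) ω ≤ τ)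
    {Xs : Profile G.M} (hXs : G.IsGloballyStable Xs)
    (hint : ∀ n, Integrable (fun ω => G.pairing Xs (X n ω) (G.V (X n ω))) μ)
    (hsum : Summable fun n => γ n * ∫ ω, -G.pairing Xs (X n ω) (G.V (X n ω)) ∂μ)
    {r : ℝ} (hr : 0 < r) :
    ∀ᵐ ω ∂μ, Summable fun n => if r ≤ ‖X n ω - Xs‖ then γ n * (1 + ‖Z n ω‖ ^ 2) else 0 := by
  classical
  obtain ⟨ε, hε, hdrift⟩ := G.exists_pairing_le_neg hXs hr
  set S : ℕ → Set Ω := fun n => {ω | r ≤ ‖X n ω - Xs‖} with hS_def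
  have hclosed : MeasurableSet {Y : Profile G.M | r ≤ ‖Y - Xs‖} :=
    (isClosed_le continuous_const (by fun_prop)).measurableSet
  have hSσ : ∀ n, MeasurableSet[sigmaOf (X n)] (S n) := fun n => by
    rw [G.sigmaOf_eq_comap]; exact ⟨_, hclosed, rfl⟩
  have hle : ∀ n, sigmaOf (X n) ≤ ‹MeasurableSpace Ω› := fun n => by
    rw [G.sigmaOf_eq_comap]; exact (hXm n).comap_le
  have hS : ∀ n, MeasurableSet (S n) := fun n => hle n _ (hSσ n)
  -- Markov's inequality, since the deficit is at least `ε` on `S n`.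
  have hprob : ∀ n, ε * μ.real (S n) ≤ ∫ ω, -G.pairing Xs (X n ω) (G.V (X n ω)) ∂μ := fun n => by
    refine le_trans ?_ (mul_meas_ge_le_integral_of_nonneg
      (Eventually.of_forall fun ω => neg_nonneg.2 (hXs.2 _ (hXf n ω)).1) (hint n).neg ε)
    refine mul_le_mul_of_nonneg_left (measureReal_mono fun ω hω => ?_) hε.le
    exact le_neg_of_le_neg (hdrift _ (hXf n ω) hω)
  set f : ℕ → Ω → ℝ := fun n => (S n).indicator fun ω => γ n * (1 + ‖Z n ω‖ ^ 2) with hf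
  have hgi : ∀ n, Integrable (fun ω => γ n * (1 + ‖Z n ω‖ ^ 2)) μ := fun n =>
    ((integrable_const _).add (hZi n)).const_mul _
  have hf0 : ∀ n ω, 0 ≤ f n ω := fun n ω =>
    Set.indicator_nonneg (fun ω _ => by have := hγ n; positivity) ω
  -- As `S n` belongs to the σ-algebra of `X n`, the conditional bound gives `E[‖Z n‖²; S n] ≤ τ P(S
  -- n)`.
  have hfint : ∀ n, ∫ ω, f n ω ∂μ ≤ (1 + τ) * (γ n * μ.real (S n)) := fun n => by
    rw [integral_indicator (hS n), integral_const_mul,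
      integral_add (integrable_const _).integrableOn (hZi n).integrableOn, setIntegral_const,
      smul_eq_mul, mul_one]
    have h := setIntegral_le_of_condExp_le (hle n) (hZi n) (hZτ n) (hSσ n)
    have := mul_le_mul_of_nonneg_left h (hγ n).le
    linarith
  have hs1 : Summable fun n => γ n * μ.real (S n) := by
    refine Summable.of_nonneg_of_le (fun n => mul_nonneg (hγ n).le measureReal_nonneg) (fun n => ?_)
      (hsum.mul_left ε⁻¹)
    have := mul_le_mul_of_nonneg_left (hprob n) (hγ n).le
    rw [inv_mul_eq_div, le_div_iff₀ hε]
    linarith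
  have hs2 : Summable fun n => ∫ ω, f n ω ∂μ :=
    Summable.of_nonneg_of_le (fun n => integral_nonneg (hf0 n)) hfint (hs1.mul_left _)
  filter_upwards [ae_summable_of_summable_integral hf0 (fun n => (hgi n).indicator (hS n)) hs2]
    with ω hω
  refine hω.congr fun n => ?_
  simp [hf, hS_def, Set.indicator_apply]

/-- The squares `γₙ² ‖Zₙ‖²` have summable expectations, so they are almost surely summable and tend
to zero. -/
theorem ae_tendsto_mul_norm [IsProbabilityMeasure μ] {γ : ℕ → ℝ} (hγ : ∀ n, 0 < γ n)
    (hγ_sq : Summable fun n => γ n ^ 2) {Z : ℕ → Ω → Profile G.M} {τ : ℝ}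
    (hZi : ∀ n, Integrable (fun ω => ‖Z n ω‖ ^ 2) μ) (hZτ : ∀ n, ∫ ω, ‖Z n ω‖ ^ 2 ∂μ ≤ τ) :
    ∀ᵐ ω ∂μ, Tendsto (fun n => γ n * ‖Z n ω‖) atTop (𝓝 0) := by
  have hs : Summable fun n => ∫ ω, γ n ^ 2 * ‖Z n ω‖ ^ 2 ∂μ := by
    refine Summable.of_nonneg_of_le (fun n => integral_nonneg fun ω => by positivity) (fun n => ?_)
      (hγ_sq.mul_right τ)
    rw [integral_const_mul]
    exact mul_le_mul_of_nonneg_left (hZτ n) (sq_nonneg _)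
  filter_upwards [ae_summable_of_summable_integral (fun n ω => by positivity)
    (fun n => (hZi n).const_mul (γ n ^ 2)) hs] with ω hω
  have h := hω.tendsto_atTop_zero.sqrt
  rw [Real.sqrt_zero] at h
  refine h.congr fun n => ?_
  rw [← mul_pow, Real.sqrt_sq (mul_nonneg (hγ n).le (norm_nonneg _))]

/-- If the actions are infinitely often close to `Xs`, with summable steps while they are away from
it, then they converge to `Xs`. -/
theorem tendsto_play_of_summable_excursions {γ : ℕ → ℝ} (hγ : ∀ n, 0 < γ n)
    (hγ0 : Tendsto γ atTop (𝓝 0))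
    (hγ_sum : Tendsto (fun n => ∑ k ∈ Finset.range n, γ k) atTop atTop)
    {Y₀ : Profile G.M} (hY₀ : ∀ i, (Y₀ i).IsHermitian) (Z : ℕ → Profile G.M) (Xs : Profile G.M)
    (hZ0 : Tendsto (fun n => γ n * ‖Z n‖) atTop (𝓝 0))
    (hexc : ∀ r > 0, Summable fun n =>
      if r ≤ ‖G.play γ Y₀ Z n - Xs‖ then γ n * (1 + ‖Z n‖ ^ 2) else 0) :
    Tendsto (G.play γ Y₀ Z) atTop (𝓝 Xs) := by
  obtain ⟨C, hC⟩ := (isCompact_feasible G.M G.A).exists_bound_of_continuousOn G.continuousOn_V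
  have hC0 : 0 ≤ C := (norm_nonneg _).trans
    (hC _ (G.expStep_mem_feasible (G.isHermitian_score γ hY₀ Z 0)))
  set L := ∑ i, G.A i * (1 + (G.M i : ℝ)) with hL_def
  have hL : 0 ≤ L := Finset.sum_nonneg fun i _ => by have := G.A_pos i; positivity
  have hδ : ∀ n, 0 ≤ L * (γ n * (C + ‖Z n‖)) := fun n => by have := hγ n; positivity
  refine tendsto_iff_norm_sub_tendsto_zero.2 (tendsto_zero_of_summable_excursions
    (δ := fun n => L * (γ n * (C + ‖Z n‖)))
    (fun n => norm_nonneg _) hδ (fun n => ?_) ?_ (fun r hr => ?_) (fun r hr => ?_))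
  · have h := G.norm_play_succ_sub_le hγ hY₀ Z hC n
    have := norm_sub_le_norm_sub_add_norm_sub (G.play γ Y₀ Z (n + 1)) (G.play γ Y₀ Z n) Xs
    linarith
  · have h := ((hγ0.mul_const C).add hZ0).const_mul L
    simp only [zero_mul, add_zero, mul_zero] at h
    exact h.congr fun n => by ring
  · refine Summable.of_nonneg_of_le (fun n => ?_) (fun n => ?_)
      ((hexc r hr).mul_left (L * (C + 1)))
    · split_ifs
      · exact hδ n
      · exact le_rfl
    · split_ifs
      -- The weight `1 + ‖Z n‖²` serves twice: here it dominates the step length, and below it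
      -- dominates `1`, which gives the returns near `Xs`.
      · have h : C + ‖Z n‖ ≤ (C + 1) * (1 + ‖Z n‖ ^ 2) := by
          nlinarith [sq_nonneg (‖Z n‖ - 1), mul_nonneg hC0 (sq_nonneg ‖Z n‖)]
        have := mul_le_mul_of_nonneg_left h (mul_nonneg hL (hγ n).le)
        linarith
      · simp
  · refine frequently_lt_of_summable_indicator hγ_sum
      (Summable.of_nonneg_of_le (fun n => ?_) (fun n => ?_) (hexc r hr))
    · split_ifs
      · exact (hγ n).le
      · exact le_rfl
    · split_ifs
      · exact le_mul_of_one_le_right (hγ n).le (by linarith [sq_nonneg ‖Z n‖])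
      · exact le_rfl

/-- Matrix exponential learning converges almost surely to a globally stable profile. -/
theorem ae_tendsto_play [IsProbabilityMeasure μ] {γ : ℕ → ℝ} (hγ : ∀ n, 0 < γ n)
    (hγ_sq : Summable fun n => γ n ^ 2)
    (hγ_sum : Tendsto (fun n => ∑ k ∈ Finset.range n, γ k) atTop atTop)
    {Y₀ : Profile G.M} (hY₀ : ∀ i, (Y₀ i).IsHermitian)
    {Z : ℕ → Ω → Profile G.M} (hZm : ∀ n, Measurable (Z n)) {X : ℕ → Ω → Profile G.M}
    (hX : ∀ n ω, X n ω = G.play γ Y₀ (fun k => Z k ω) n)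
    (hH1 : ZeroMean μ X Z) (hH2 : FiniteMSE μ X Z)
    {Xs : Profile G.M} (hXs : G.IsGloballyStable Xs) :
    ∀ᵐ ω ∂μ, Tendsto (fun n => X n ω) atTop (𝓝 Xs) := by
  obtain ⟨σ, -, hσ⟩ := hH2
  have hYh := fun n ω => G.isHermitian_score γ hY₀ (fun k => Z k ω) n
  have hXf : ∀ n ω, X n ω ∈ feasible G.M G.A := fun n ω =>
    hX n ω ▸ G.expStep_mem_feasible (hYh n ω)
  have hXm : ∀ n, Measurable (X n) := fun n => by
    rw [funext (hX n)]
    exact G.measurable_expStep_comp (G.measurable_score γ hY₀ hZm n) (hYh n)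
  have hZi : ∀ n, Integrable (fun ω => ‖Z n ω‖ ^ 2) μ := fun n => (hσ n).1
  have hZτ : ∀ n, ∀ᵐ ω ∂μ, (μ[fun ω => ‖Z n ω‖ ^ 2 | sigmaOf (X n)]) ω ≤ σ ^ 2 :=
    fun n => (hσ n).2
  have hle : ∀ n, sigmaOf (X n) ≤ ‹MeasurableSpace Ω› := fun n => by
    rw [G.sigmaOf_eq_comap]; exact (hXm n).comap_le
  have hZσ : ∀ n, ∫ ω, ‖Z n ω‖ ^ 2 ∂μ ≤ σ ^ 2 := fun n => by
    simpa using setIntegral_le_of_condExp_le (hle n) (hZi n) (hZτ n) MeasurableSet.univ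
  obtain ⟨hint, hsum⟩ := G.summable_integral_neg_pairing hγ hγ_sq hY₀ hZm hX hXm hXf hH1 hZi hZσ hXs
  -- Countably many radii suffice and keep the exceptional null set independent of `r`.
  have hexc : ∀ᵐ ω ∂μ, ∀ j : ℕ, Summable fun n =>
      if 1 / ((j : ℝ) + 1) ≤ ‖X n ω - Xs‖ then γ n * (1 + ‖Z n ω‖ ^ 2) else 0 :=
    ae_all_iff.2 fun j => G.ae_summable_excursions hγ hXm hXf hZi hZτ hXs hint hsum
      Nat.one_div_pos_of_nat
  have hγ0 : Tendsto γ atTop (𝓝 0) := by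
    have h := hγ_sq.tendsto_atTop_zero.sqrt
    rw [Real.sqrt_zero] at h
    exact h.congr fun n => Real.sqrt_sq (hγ n).le
  filter_upwards [hexc, G.ae_tendsto_mul_norm hγ hγ_sq hZi hZσ] with ω hω hω0
  rw [funext fun n => hX n ω]
  refine G.tendsto_play_of_summable_excursions hγ hγ0 hγ_sum hY₀ _ Xs hω0 fun r hr => ?_
  obtain ⟨j, hj⟩ := exists_nat_one_div_lt hr
  simp_rw [← hX]
  have hpos : ∀ n, 0 ≤ γ n * (1 + ‖Z n ω‖ ^ 2) := fun n => by have := hγ n; positivity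
  -- Times at distance at least `r` are among those at distance at least `1 / (j + 1) < r`.
  refine Summable.of_nonneg_of_le (fun n => ?_) (fun n => ?_) (hω j)
  · split_ifs
    · exact hpos n
    · exact le_rfl
  · by_cases h : r ≤ ‖X n ω - Xs‖
    · rw [if_pos h, if_pos (hj.le.trans h)]
    · rw [if_neg h]
      split_ifs
      · exact hpos n
      · exact le_rfl

end Game

end MXL

end

theorem mainTheorem1 {N : ℕ} (G : MXL.Game N)
    {Ω : Type*} [MeasurableSpace Ω] (μ : Measure Ω) [IsProbabilityMeasure μ]
    (γ : ℕ → ℝ) (hγ : ∀ n, 0 < γ n)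
    (hγ_sq : Summable fun n => γ n ^ 2)
    (hγ_sum : Tendsto (fun n => ∑ k ∈ Finset.range n, γ k) atTop atTop)
    (Y₀ : MXL.Profile G.M) (hY₀ : ∀ i, (Y₀ i).IsHermitian)
    (Z : ℕ → Ω → MXL.Profile G.M) (hZ : ∀ n i a b, Measurable fun ω => Z n ω i a b)
    (X : ℕ → Ω → MXL.Profile G.M)
    (hX : ∀ n ω, X n ω = G.play γ Y₀ (fun k => Z k ω) n)
    (hH1 : MXL.ZeroMean μ X Z) (hH2 : MXL.FiniteMSE μ X Z)
    (Xs : MXL.Profile G.M) (hXs : G.IsGloballyStable Xs) :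
    ∀ᵐ ω ∂μ, Tendsto (fun n => X n ω) atTop (𝓝 Xs) :=
  G.ae_tendsto_play hγ hγ_sq hγ_sum hY₀ (fun n => MXL.measurable_profile (hZ n)) hX hH1 hH2 hXs
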